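/- For $n\ge 1$ let $\mathcal S_n$ be the set of permutations of $\{1,\dots,n\}$. For $\pi\in\mathcal S_n$ write $\pi$ as a product of disjoint cycles (including fixed points as $1$-cycles), each cycle written with its smallest element first and the cycles arranged from left to right in increasing order of their smallest elements; $\mathrm{Flatten}(\pi)$ is the word of length $n$ obtained by erasing the parentheses. A pattern of type $(2,1)$ is $p=xy\text{-}z$, where $xyz$ is one of the six permutations of $\{1,2,3\}$. An occurrence of $p$ in a word $w=w_1w_2\cdots w_n\in\mathcal S_n$ is a pair of indices $2\le i<j\le n$ such that $w_{i-1}w_iw_j$ is order-isomorphic to $xyz$. Theorem. For every pattern $p$ of type $(2,1)$, the average number $$\mathrm{avr}(n)=\frac1{n!}\sum_{\pi\in\mathcal S_n}\#\{\text{occurrences of }p\text{ in }\mathrm{Flatten}(\pi)\}$$ of occurrences of $p$ in $\mathrm{Flatten}(\pi)$ over all $\pi\in\mathcal S_n$ satisfies $$\lim_{n\to\infty}\frac{\mathrm{avr}(n)}{n^2}=\frac1{12}.$$ -/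

import Mathlib

namespace FlattenedPerm

/-- The word of the cycle of `π` containing `a`, written starting from `a`:
`a, π a, π (π a), …` (Mathlib's `Equiv.Perm.toList` is empty at a fixed point, whose cycle is
the one-letter word `a`). -/
def cycleWord {n : ℕ} (π : Equiv.Perm (Fin n)) (a : Fin n) : List (Fin n) :=
  if π a = a then [a] else π.toList a

/-- `a` is the smallest element of its cycle. -/
def IsCycleMin {n : ℕ} (π : Equiv.Perm (Fin n)) (a : Fin n) : Prop :=
  ∀ b, π.SameCycle a b → a ≤ b

instance {n : ℕ} (π : Equiv.Perm (Fin n)) : DecidablePred (IsCycleMin π) :=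
  fun _ => inferInstanceAs (Decidable (∀ _, _ → _))

/-- The word `Flatten(π)`: the cycles of `π`, each written with its smallest element first,
are concatenated in increasing order of their smallest elements. -/
def flatten {n : ℕ} (π : Equiv.Perm (Fin n)) : List (Fin n) :=
  ((List.finRange n).filter (fun a => IsCycleMin π a)).flatMap (cycleWord π)

/-- The three letters `u 0, u 1, u 2` are order-isomorphic to the word
`σ 0, σ 1, σ 2` of the permutation `σ`. -/
def OrderIsomorphic {n : ℕ} (u : Fin 3 → Fin n) (σ : Equiv.Perm (Fin 3)) : Prop :=
  ∀ a b : Fin 3, u a < u b ↔ σ a < σ b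

instance {n : ℕ} (u : Fin 3 → Fin n) (σ : Equiv.Perm (Fin 3)) :
    Decidable (OrderIsomorphic u σ) :=
  inferInstanceAs (Decidable (∀ _ _, _ ↔ _))

/-- The number of occurrences in the word `w` of the pattern `xy-z` of type `(2,1)`, where
`xyz` is the word of `σ`: triples of positions `i, j, k` with `j = i + 1` and `j < k` at which
the letters of `w` are order-isomorphic to `xyz`. -/
def occ {n : ℕ} (σ : Equiv.Perm (Fin 3)) (w : List (Fin n)) : ℕ :=
  (Finset.univ.filter fun t : Fin w.length × Fin w.length × Fin w.length =>
    (t.2.1 : ℕ) = t.1 + 1 ∧ t.2.1 < t.2.2 ∧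
      OrderIsomorphic ![w.get t.1, w.get t.2.1, w.get t.2.2] σ).card

/-- The average number of occurrences of the pattern of type `(2,1)` given by `σ` in
`Flatten(π)`, over all permutations `π` of length `n`. -/
noncomputable def avr (σ : Equiv.Perm (Fin 3)) (n : ℕ) : ℝ :=
  (∑ π : Equiv.Perm (Fin n), (occ σ (flatten π) : ℝ)) / (Nat.factorial n : ℝ)

end FlattenedPerm

namespace FlattenedPerm

open Equiv

variable {n : ℕ}

/-! ### The flattened word -/

/-! Each `Flatten(π)` has (n-1)(n-2)/2 position triples of type (2,1), and each realises exactly one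
of the six patterns (`sum_occ_mul_two`). It therefore suffices that any two averages differ by
o(n²).

To compare σ with σ', conjugate π by the permutation of three occurring letters that turns σ into
σ'. If each of their cycles contains an element below all three letters, the cycle minima do not
move, so the flattened word is merely relabelled (`IsDeep.flatten_conj`); this gives an injection
(`card_deep_occurrences_le`).

In any other occurrence some letter is below T or has a cycle avoiding all elements below T. A given
element has such a cycle with probability at most 1/T (`mul_card_shallow_le`), so on average there
are at most T + n/T exceptional letters, each in at most 3n occurrences (`card_not_deep_le`). With T
= ⌊√n⌋ the error is O(n^(3/2)). -/

theorem mem_cycleWord {π : Perm (Fin n)} {a x : Fin n} :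
    x ∈ cycleWord π a ↔ π.SameCycle a x := by
  unfold cycleWord
  split_ifs with h
  · rw [List.mem_singleton]
    exact ⟨fun hx => hx ▸ Perm.SameCycle.refl π a, fun hx => (hx.eq_of_left h).symm⟩
  · rw [Perm.mem_toList_iff, and_iff_left (Perm.mem_support.mpr h)]

theorem nodup_cycleWord (π : Perm (Fin n)) (a : Fin n) : (cycleWord π a).Nodup := by
  unfold cycleWord
  split_ifs
  · exact List.nodup_singleton a
  · exact Perm.nodup_toList π a

theorem IsCycleMin.eq_of_sameCycle {π : Perm (Fin n)} {a b : Fin n} (ha : IsCycleMin π a)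
    (hb : IsCycleMin π b) (h : π.SameCycle a b) : a = b :=
  le_antisymm (ha b h) (hb a h.symm)

theorem exists_isCycleMin_sameCycle (π : Perm (Fin n)) (x : Fin n) :
    ∃ a, IsCycleMin π a ∧ π.SameCycle a x := by
  classical
  obtain ⟨a, ha, hmin⟩ := (Finset.univ.filter fun b => π.SameCycle x b).exists_min_image id
    ⟨x, by simp [Perm.SameCycle.refl]⟩
  have hxa : π.SameCycle x a := by simpa using ha
  exact ⟨a, fun b hb => hmin b (by simpa using hxa.trans hb), hxa.symm⟩

theorem mem_flatten (π : Perm (Fin n)) (x : Fin n) : x ∈ flatten π := by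
  obtain ⟨a, ha, hax⟩ := exists_isCycleMin_sameCycle π x
  simp only [flatten, List.mem_flatMap, List.mem_filter, List.mem_finRange, true_and,
    decide_eq_true_eq]
  exact ⟨a, ha, mem_cycleWord.mpr hax⟩

theorem nodup_flatten (π : Perm (Fin n)) : (flatten π).Nodup := by
  rw [flatten, List.nodup_flatMap]
  refine ⟨fun a _ => nodup_cycleWord π a, ?_⟩
  refine List.Pairwise.imp_of_mem ?_ ((List.nodup_finRange n).filter _)
  intro a b ha hb hab x hxa hxb
  simp only [List.mem_filter, decide_eq_true_eq] at ha hb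
  exact hab (ha.2.eq_of_sameCycle hb.2
    ((mem_cycleWord.mp hxa).trans (mem_cycleWord.mp hxb).symm))

theorem length_flatten (π : Perm (Fin n)) : (flatten π).length = n := by
  have h : (flatten π).toFinset = Finset.univ :=
    Finset.eq_univ_of_forall fun x => List.mem_toFinset.mpr (mem_flatten π x)
  rw [← List.toFinset_card_of_nodup (nodup_flatten π), h, Finset.card_univ, Fintype.card_fin]

/-! ### Conjugation -/

theorem conj_pow_apply (τ π : Perm (Fin n)) (k : ℕ) (x : Fin n) :
    ((τ * π * τ⁻¹) ^ k) (τ x) = τ ((π ^ k) x) := by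
  simp [conj_pow]

theorem card_support_cycleOf_conj (τ π : Perm (Fin n)) (x : Fin n) :
    ((τ * π * τ⁻¹).cycleOf (τ x)).support.card = (π.cycleOf x).support.card := by
  by_cases h : π x = x
  · rw [Perm.cycleOf_eq_one_iff _ |>.mpr h, Perm.cycleOf_eq_one_iff _ |>.mpr (by simp [h])]
  · refine (Finset.card_equiv τ fun y => ?_).symm
    rw [Perm.mem_support_cycleOf_iff' h, Perm.mem_support_cycleOf_iff' (by simpa using h),
      Perm.sameCycle_conj]
    simp

theorem cycleWord_conj (τ π : Perm (Fin n)) (x : Fin n) :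
    cycleWord (τ * π * τ⁻¹) (τ x) = (cycleWord π x).map τ := by
  have hiff : (τ * π * τ⁻¹) (τ x) = τ x ↔ π x = x := by simp
  unfold cycleWord
  by_cases h : π x = x
  · rw [if_pos h, if_pos (hiff.mpr h), List.map_singleton]
  · rw [if_neg h, if_neg (mt hiff.mp h)]
    refine List.ext_getElem ?_ fun i h₁ h₂ => ?_
    · rw [List.length_map, Perm.length_toList, Perm.length_toList, card_support_cycleOf_conj]
    · rw [List.getElem_map, Perm.getElem_toList, Perm.getElem_toList, conj_pow_apply]

/-- The cycle of every letter `u a` contains an element smaller than all the letters of `u`. -/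
def IsDeep (π : Perm (Fin n)) (u : Fin 3 → Fin n) : Prop :=
  ∀ a, ∃ y, π.SameCycle (u a) y ∧ ∀ b, y < u b

theorem IsDeep.notMem_range {π : Perm (Fin n)} {u : Fin 3 → Fin n} (hu : IsDeep π u)
    {x : Fin n} (hx : IsCycleMin π x) : x ∉ Set.range u := by
  rintro ⟨a, rfl⟩
  obtain ⟨y, hy, hlt⟩ := hu a
  exact (hlt a).not_ge (hx y hy)

/-- A letter of `u` is never a cycle minimum, before or after conjugation: its cycle contains a `y`
below all letters of `u`, and `τ` fixes `y`. For the same reason any comparison of a minimum with a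
letter of `u` can be routed through `y`. -/
theorem IsDeep.isCycleMin_conj_iff {π τ : Perm (Fin n)} {u : Fin 3 → Fin n} (hu : IsDeep π u)
    (hτ : ∀ x ∉ Set.range u, τ x = x) (hτu : ∀ a, ∃ b, τ (u a) = u b) (x : Fin n) :
    IsCycleMin (τ * π * τ⁻¹) x ↔ IsCycleMin π x := by
  have key : ∀ a, ∃ y, π.SameCycle (u a) y ∧ τ y = y ∧ ∀ b, y < u b := fun a => by
    obtain ⟨y, hy, hlt⟩ := hu a
    refine ⟨y, hy, hτ y ?_, hlt⟩
    rintro ⟨b, rfl⟩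
    exact lt_irrefl _ (hlt b)
  constructor
  · intro h
    have hconj : ∀ c, π.SameCycle (τ⁻¹ x) c → x ≤ τ c := fun c hc =>
      h _ (by rw [Perm.sameCycle_conj]; simpa using hc)
    have hx : τ⁻¹ x ∉ Set.range u := by
      rintro ⟨a, ha⟩
      obtain ⟨y, hy, hτy, hlt⟩ := key a
      obtain ⟨b, hb⟩ := hτu a
      have h₁ := hconj y (ha ▸ hy)
      have h₂ : x = u b := by rw [← hb, ha]; simp
      rw [hτy, h₂] at h₁
      exact (hlt b).not_ge h₁
    have hfix : τ⁻¹ x = x := by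
      have := hτ _ hx
      simpa using this.symm
    rw [hfix] at hconj
    intro c hc
    by_cases hcu : c ∈ Set.range u
    · obtain ⟨a, rfl⟩ := hcu
      obtain ⟨y, hy, hτy, hlt⟩ := key a
      have := hconj y (hc.trans hy)
      rw [hτy] at this
      exact this.trans (hlt a).le
    · simpa [hτ c hcu] using hconj c hc
  · intro h b hb
    have hfix : τ⁻¹ x = x := by
      rw [Perm.inv_eq_iff_eq, hτ x (hu.notMem_range h)]
    rw [Perm.sameCycle_conj, hfix] at hb
    obtain ⟨c, rfl⟩ : ∃ c, τ c = b := ⟨τ⁻¹ b, by simp⟩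
    replace hb : π.SameCycle x c := by simpa using hb
    by_cases hcu : c ∈ Set.range u
    · obtain ⟨a, rfl⟩ := hcu
      obtain ⟨y, hy, -, hlt⟩ := key a
      obtain ⟨b, hb'⟩ := hτu a
      rw [hb']
      exact (h y (hb.trans hy)).trans (hlt b).le
    · rw [hτ c hcu]
      exact h c hb

theorem IsDeep.flatten_conj {π τ : Perm (Fin n)} {u : Fin 3 → Fin n} (hu : IsDeep π u)
    (hτ : ∀ x ∉ Set.range u, τ x = x) (hτu : ∀ a, ∃ b, τ (u a) = u b) :
    flatten (τ * π * τ⁻¹) = (flatten π).map τ := by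
  unfold flatten
  simp only [hu.isCycleMin_conj_iff hτ hτu, List.map_flatMap]
  refine List.flatMap_congr fun a ha => ?_
  simp only [List.mem_filter, decide_eq_true_eq] at ha
  rw [← cycleWord_conj, hτ a (hu.notMem_range ha.2)]

/-! ### Elements whose cycle avoids the small elements -/

/-- The cycle of `x` avoids all elements below `T`. -/
def Shallow (T : ℕ) (π : Perm (Fin n)) (x : Fin n) : Prop :=
  ∀ y, π.SameCycle x y → T ≤ (y : ℕ)

/-- The `π`-cycle of `x` contains neither `t` nor `s`, so `ρ` agrees with `π` on it except perhaps
at `x`, while `ρ t = π x`. Iterating `ρ` from `t` thus traces `π x, π² x, …` until it reaches `x`.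
-/
theorem Shallow.sameCycle_of_mul_swap_eq {T : ℕ} {π ρ : Perm (Fin n)} {x t s : Fin n}
    (hπ : Shallow T π x) (ht : (t : ℕ) < T) (hs : (s : ℕ) < T) (hts : t ≠ s)
    (h : π * swap x t = ρ * swap x s) : ρ.SameCycle t x := by
  have hxT : T ≤ (x : ℕ) := hπ x (Perm.SameCycle.refl π x)
  have hxt : x ≠ t := by rintro rfl; omega
  have hxs : x ≠ s := by rintro rfl; omega
  have happ : ∀ y, π (swap x t y) = ρ (swap x s y) := fun y => congrArg (fun f : Perm _ => f y) h
  have hρt : ρ t = π x := by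
    have := happ t
    rw [swap_apply_right, swap_apply_of_ne_of_ne hxt.symm hts] at this
    exact this.symm
  have hstep : ∀ k : ℕ, ρ.SameCycle t x ∨ ρ.SameCycle t ((π ^ (k + 1)) x) := by
    intro k
    induction k with
    | zero =>
      right
      rw [zero_add, pow_one, ← hρt]
      exact Perm.sameCycle_apply_right.mpr (Perm.SameCycle.refl ρ t)
    | succ k ih =>
      rcases ih with ih | ih
      · exact Or.inl ih
      · by_cases hy : (π ^ (k + 1)) x = x
        · rw [hy] at ih
          exact Or.inl ih
        · right
          have hyT : T ≤ (((π ^ (k + 1)) x : Fin n) : ℕ) :=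
            hπ _ (Perm.sameCycle_pow_right.mpr (Perm.SameCycle.refl π x))
          have := happ ((π ^ (k + 1)) x)
          rw [swap_apply_of_ne_of_ne hy (by rintro h; rw [h] at hyT; omega),
            swap_apply_of_ne_of_ne hy (by rintro h; rw [h] at hyT; omega)] at this
          rw [pow_succ', Perm.mul_apply, this]
          exact Perm.sameCycle_apply_right.mpr ih
  -- Taking the exponent `k + 1` equal to the order of `π` returns to `x`.
  rcases hstep (orderOf π - 1) with h | h
  · exact h
  · rwa [Nat.sub_add_cancel (orderOf_pos π), pow_orderOf_eq_one] at h

open Classical in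
-- The map `(t, π) ↦ π * swap x t` is injective for `t` below `T` and `π` shallow at `x`: a
-- collision with different `t` would put an element below `T` in the cycle of `x`.
theorem mul_card_shallow_le {T : ℕ} (hT : T ≤ n) (x : Fin n) :
    T * (Finset.univ.filter fun π : Perm (Fin n) => Shallow T π x).card ≤ n.factorial := by
  let S := Finset.univ.filter fun π : Perm (Fin n) => Shallow T π x
  have hinj : Set.InjOn (fun p : Fin T × Perm (Fin n) => p.2 * swap x (Fin.castLE hT p.1))
      (Finset.univ ×ˢ S : Finset (Fin T × Perm (Fin n))) := by
    rintro ⟨t, π⟩ hπ ⟨s, ρ⟩ hρ h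
    simp only [S, Finset.coe_product, Set.mem_prod, Finset.mem_coe, Finset.mem_univ, true_and,
      Finset.mem_filter] at hπ hρ h
    by_cases hts : t = s
    · subst hts
      rw [mul_right_cancel h]
    · have hcyc := hπ.sameCycle_of_mul_swap_eq (t := Fin.castLE hT t) (s := Fin.castLE hT s)
        t.2 s.2 (fun h => hts (Fin.castLE_injective hT h)) h
      exact absurd (hρ _ hcyc.symm) (by simp)
  calc T * S.card = (Finset.univ ×ˢ S : Finset (Fin T × Perm (Fin n))).card := by simp
    _ ≤ (Finset.univ : Finset (Perm (Fin n))).card :=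
        Finset.card_le_card_of_injOn _ (fun _ _ => Finset.mem_coe.mpr (Finset.mem_univ _)) hinj
    _ = n.factorial := by rw [Finset.card_univ, Fintype.card_perm, Fintype.card_fin]

/-! ### Occurrences in terms of letters -/

/-- In the word `w`, the letter `u 1` immediately follows `u 0`, and `u 2` occurs later. -/
def Follows (w : List (Fin n)) (u : Fin 3 → Fin n) : Prop :=
  ∃ i k, i + 1 < k ∧ w[i]? = some (u 0) ∧ w[i + 1]? = some (u 1) ∧ w[k]? = some (u 2)

theorem Follows.map {w : List (Fin n)} {u : Fin 3 → Fin n} (h : Follows w u)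
    (τ : Fin n → Fin n) : Follows (w.map τ) (τ ∘ u) := by
  obtain ⟨i, k, hik, h0, h1, h2⟩ := h
  exact ⟨i, k, hik, by simp [h0], by simp [h1], by simp [h2]⟩

theorem getElem?_index_unique {w : List (Fin n)} (hw : w.Nodup) {i j : ℕ} {x : Fin n}
    (hi : w[i]? = some x) (hj : w[j]? = some x) : i = j := by
  obtain ⟨hi', hi⟩ := List.getElem?_eq_some_iff.mp hi
  obtain ⟨hj', hj⟩ := List.getElem?_eq_some_iff.mp hj
  exact (hw.getElem_inj_iff).mp (hi.trans hj.symm)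

theorem Follows.eq_of_first {w : List (Fin n)} (hw : w.Nodup) {u v : Fin 3 → Fin n}
    (hu : Follows w u) (hv : Follows w v) (h0 : u 0 = v 0) : u 1 = v 1 := by
  obtain ⟨i, k, -, hi, hj, -⟩ := hu
  obtain ⟨i', k', -, hi', hj', -⟩ := hv
  rw [← h0] at hi'
  obtain rfl := getElem?_index_unique hw hi hi'
  exact Option.some_injective _ (hj.symm.trans hj')

theorem Follows.eq_of_second {w : List (Fin n)} (hw : w.Nodup) {u v : Fin 3 → Fin n}
    (hu : Follows w u) (hv : Follows w v) (h1 : u 1 = v 1) : u 0 = v 0 := by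
  obtain ⟨i, k, -, hi, hj, -⟩ := hu
  obtain ⟨i', k', -, hi', hj', -⟩ := hv
  rw [← h1] at hj'
  obtain rfl : i = i' := Nat.succ_injective (getElem?_index_unique hw hj hj')
  exact Option.some_injective _ (hi.symm.trans hi')

open Classical in
-- Counting by letters instead of positions lets relabellings act on occurrences.
theorem occ_eq_card_follows (σ : Perm (Fin 3)) {w : List (Fin n)} (hw : w.Nodup) :
    occ σ w = (Finset.univ.filter fun u : Fin 3 → Fin n =>
      Follows w u ∧ OrderIsomorphic u σ).card := by
  unfold occ
  refine Finset.card_bij (fun t _ => ![w.get t.1, w.get t.2.1, w.get t.2.2]) ?_ ?_ ?_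
  · rintro ⟨i, j, k⟩ ht
    simp only [Finset.mem_filter, Finset.mem_univ, true_and] at ht ⊢
    obtain ⟨hij, hjk, hσ⟩ := ht
    refine ⟨⟨i, k, by omega, by simp, ?_, by simp⟩, hσ⟩
    rw [← hij]
    simp
  · rintro ⟨i, j, k⟩ - ⟨i', j', k'⟩ - h
    have h0 := congrFun h 0
    have h1 := congrFun h 1
    have h2 := congrFun h 2
    simp only [Matrix.cons_val] at h0 h1 h2
    rw [hw.injective_get h0, hw.injective_get h1, hw.injective_get h2]
  · intro u hu
    simp only [Finset.mem_filter, Finset.mem_univ, true_and] at hu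
    obtain ⟨⟨i, k, hik, h0, h1, h2⟩, hσ⟩ := hu
    obtain ⟨hi, h0⟩ := List.getElem?_eq_some_iff.mp h0
    obtain ⟨hj, h1⟩ := List.getElem?_eq_some_iff.mp h1
    obtain ⟨hk, h2⟩ := List.getElem?_eq_some_iff.mp h2
    have hu : ![w.get ⟨i, hi⟩, w.get ⟨i + 1, hj⟩, w.get ⟨k, hk⟩] = u := by
      ext a
      fin_cases a <;> simp [h0, h1, h2]
    refine ⟨(⟨i, hi⟩, ⟨i + 1, hj⟩, ⟨k, hk⟩), ?_, hu⟩
    simp only [Finset.mem_filter, Finset.mem_univ, true_and, hu]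
    exact ⟨hik, hσ⟩

/-! ### Order-isomorphism type of three letters -/

theorem OrderIsomorphic.injective {u : Fin 3 → Fin n} {σ : Perm (Fin 3)}
    (h : OrderIsomorphic u σ) : Function.Injective u := by
  intro a b hab
  apply σ.injective
  have h₁ := h a b
  have h₂ := h b a
  rw [hab] at h₁ h₂
  simp only [lt_irrefl, false_iff, not_lt] at h₁ h₂
  exact le_antisymm h₂ h₁

theorem OrderIsomorphic.comp {u : Fin 3 → Fin n} {σ : Perm (Fin 3)} (h : OrderIsomorphic u σ)
    (ρ : Perm (Fin 3)) : OrderIsomorphic (u ∘ ρ) (σ * ρ) :=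
  fun a b => h (ρ a) (ρ b)

theorem existsUnique_orderIsomorphic {u : Fin 3 → Fin n} (hu : Function.Injective u) :
    ∃! σ : Perm (Fin 3), OrderIsomorphic u σ := by
  have hmono : StrictMono (u ∘ Tuple.sort u) :=
    (Tuple.monotone_sort u).strictMono_of_injective (hu.comp (Tuple.sort u).injective)
  have hsort : OrderIsomorphic u (Tuple.sort u)⁻¹ := fun a b => by
    simpa using hmono.lt_iff_lt (a := (Tuple.sort u)⁻¹ a) (b := (Tuple.sort u)⁻¹ b)
  refine ⟨_, hsort, fun σ hσ => ?_⟩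
  -- A strictly monotone permutation of `Fin 3` is the identity, which forces `σ` to be the inverse
  -- of the sorting permutation.
  have hid : StrictMono (σ * Tuple.sort u) := fun a b hab =>
    (hσ _ _).mp (hmono hab)
  rw [eq_inv_iff_mul_eq_one]
  ext a
  have := congrFun (Subsingleton.elim
    (StrictMono.orderIsoOfSurjective _ hid (σ * Tuple.sort u).surjective)
    (OrderIso.refl (Fin 3)) ▸ rfl : ⇑(StrictMono.orderIsoOfSurjective _ hid
      (σ * Tuple.sort u).surjective) = ⇑(OrderIso.refl (Fin 3))) a
  simpa using congrArg Fin.val this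

theorem card_adjacent_triples (m : ℕ) :
    (Finset.univ.filter fun t : Fin m × Fin m × Fin m =>
      (t.2.1 : ℕ) = t.1 + 1 ∧ t.2.1 < t.2.2).card * 2 = (m - 1) * (m - 2) := by
  have h : (Finset.univ.filter fun t : Fin m × Fin m × Fin m =>
      (t.2.1 : ℕ) = t.1 + 1 ∧ t.2.1 < t.2.2).card =
      ((Finset.range (m - 1)).sigma fun k => Finset.range k).card := by
    -- The middle position is redundant; shifting the last one down by 1 turns `i + 1 < k` into `i <
    -- k - 1`.
    refine Finset.card_bij (fun t _ => ⟨(t.2.2 : ℕ) - 1, t.1⟩) ?_ ?_ ?_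
    · rintro ⟨i, j, k⟩ ht
      simp only [Finset.mem_filter, Finset.mem_univ, true_and, Fin.lt_def] at ht
      simp only [Finset.mem_sigma, Finset.mem_range]
      omega
    · rintro ⟨i, j, k⟩ ht ⟨i', j', k'⟩ ht' h
      simp only [Finset.mem_filter, Finset.mem_univ, true_and, Fin.lt_def] at ht ht'
      simp only [Sigma.mk.injEq, heq_eq_eq] at h
      simp only [Prod.mk.injEq, Fin.ext_iff]
      omega
    · rintro ⟨k, i⟩ h
      simp only [Finset.mem_sigma, Finset.mem_range] at h
      refine ⟨(⟨i, by omega⟩, ⟨i + 1, by omega⟩, ⟨k + 1, by omega⟩), ?_, rfl⟩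
      simp only [Finset.mem_filter, Finset.mem_univ, true_and, Fin.lt_def]
      omega
  rw [h, Finset.card_sigma]
  simp only [Finset.card_range]
  rw [Finset.sum_range_id_mul_two, Nat.sub_sub]

theorem sum_occ_mul_two {w : List (Fin n)} (hw : w.Nodup) :
    (∑ σ : Perm (Fin 3), occ σ w) * 2 = (w.length - 1) * (w.length - 2) := by
  classical
  rw [← card_adjacent_triples]
  congr 1
  unfold occ
  rw [← Finset.card_biUnion]
  · congr 1
    ext t
    simp only [Finset.mem_biUnion, Finset.mem_filter, Finset.mem_univ, true_and]
    constructor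
    · rintro ⟨σ, h₁, h₂, -⟩
      exact ⟨h₁, h₂⟩
    · rintro ⟨h₁, h₂⟩
      obtain ⟨σ, hσ, -⟩ := existsUnique_orderIsomorphic
        (u := ![w.get t.1, w.get t.2.1, w.get t.2.2]) (by
          have e : ![w.get t.1, w.get t.2.1, w.get t.2.2] = w.get ∘ ![t.1, t.2.1, t.2.2] := by
            ext a
            fin_cases a <;> rfl
          rw [e]
          refine hw.injective_get.comp (StrictMono.injective ?_)
          have : t.1 < t.2.1 := by rw [Fin.lt_def]; omega
          rw [Fin.strictMono_iff_lt_succ]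
          intro a
          fin_cases a
          · exact this
          · exact h₂)
      exact ⟨σ, h₁, h₂, hσ⟩
  · intro σ _ σ' _ hne
    rw [Function.onFun, Finset.disjoint_left]
    intro t ht hs
    simp only [Finset.mem_filter, Finset.mem_univ, true_and] at ht hs
    exact hne ((existsUnique_orderIsomorphic ht.2.2.injective).unique ht.2.2 hs.2.2)

/-! ### Comparing two patterns -/

open Classical in
/-- The pairs of a permutation and a triple of letters forming an occurrence of `σ` in its
flattened word. -/
noncomputable def occurrences (n : ℕ) (σ : Perm (Fin 3)) :
    Finset (Perm (Fin n) × (Fin 3 → Fin n)) :=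
  Finset.univ.filter fun p => Follows (flatten p.1) p.2 ∧ OrderIsomorphic p.2 σ

theorem sum_occ_flatten (σ : Perm (Fin 3)) :
    ∑ π : Perm (Fin n), occ σ (flatten π) = (occurrences n σ).card := by
  classical
  simp only [occ_eq_card_follows σ (nodup_flatten _), occurrences, Finset.card_filter,
    Fintype.sum_prod_type]

open Classical in
-- The map `(π, u) ↦ (τ π τ⁻¹, u ∘ ρ)`, with `τ` acting as `ρ` on the letters of `u`, is injective:
-- `u ∘ ρ` determines `u`, hence `τ`, hence `π`.
theorem card_deep_occurrences_le (σ σ' : Perm (Fin 3)) :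
    ((occurrences n σ).filter fun p => IsDeep p.1 p.2).card ≤ (occurrences n σ').card := by
  -- Chosen so that `σ * ρ = σ'`. The default value 1 of `τ` is never met on an occurrence, whose
  -- letters are distinct.
  let ρ : Perm (Fin 3) := σ⁻¹ * σ'
  let τ : (Fin 3 → Fin n) → Perm (Fin n) := fun u =>
    if hu : Function.Injective u then ρ.viaEmbedding ⟨u, hu⟩ else 1
  have hτ : ∀ u, Function.Injective u → τ u ∘ u = u ∘ ρ := fun u hu => by
    funext a
    simp only [τ, dif_pos hu]
    exact Perm.viaEmbedding_apply ρ ⟨u, hu⟩ a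
  have hτ' : ∀ u, Function.Injective u → ∀ x ∉ Set.range u, τ u x = x := fun u hu x hx => by
    simp only [τ, dif_pos hu]
    exact Perm.viaEmbedding_apply_of_notMem ρ ⟨u, hu⟩ x hx
  refine Finset.card_le_card_of_injOn (fun p => (τ p.2 * p.1 * (τ p.2)⁻¹, p.2 ∘ ρ)) ?_ ?_
  · rintro ⟨π, u⟩ h
    simp only [occurrences, Finset.coe_filter, Set.mem_ofPred_eq, Finset.mem_filter,
      Finset.mem_univ, true_and] at h ⊢
    obtain ⟨⟨hf, hσ⟩, hd⟩ := h
    have hu := hσ.injective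
    refine ⟨?_, ?_⟩
    · rw [hd.flatten_conj (hτ' u hu) fun a => ⟨ρ a, congrFun (hτ u hu) a⟩, ← hτ u hu]
      exact hf.map _
    · have := hσ.comp ρ
      rwa [mul_inv_cancel_left] at this
  · rintro ⟨π, u⟩ - ⟨π', u'⟩ - h
    simp only [Prod.mk.injEq] at h
    obtain ⟨h₁, h₂⟩ := h
    obtain rfl := ρ.surjective.injective_comp_right h₂
    have hπ : π = π' := mul_left_cancel (mul_right_cancel h₁)
    rw [hπ]

open Classical in
/-- The elements below `T`, and those whose cycle avoids all elements below `T`. -/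
noncomputable def exceptional (T : ℕ) (π : Perm (Fin n)) : Finset (Fin n) :=
  Finset.univ.filter fun x => (x : ℕ) < T ∨ Shallow T π x

theorem exists_mem_exceptional (T : ℕ) {π : Perm (Fin n)} {u : Fin 3 → Fin n}
    (h : ¬ IsDeep π u) : ∃ a, u a ∈ exceptional T π := by
  by_contra! hne
  simp only [exceptional, Finset.mem_filter, Finset.mem_univ, true_and, not_or, not_lt] at hne
  refine h fun a => ?_
  have := (hne a).2
  unfold Shallow at this
  push Not at this
  obtain ⟨y, hy, hlt⟩ := this
  exact ⟨y, hy, fun b => Fin.lt_def.mpr (hlt.trans_le (hne b).1)⟩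

open Classical in
theorem card_not_deep_le (T : ℕ) (π : Perm (Fin n)) (σ : Perm (Fin 3)) :
    (Finset.univ.filter fun u : Fin 3 → Fin n =>
      (Follows (flatten π) u ∧ OrderIsomorphic u σ) ∧ ¬ IsDeep π u).card ≤
      3 * n * (exceptional T π).card := by
  let F := Finset.univ.filter fun u : Fin 3 → Fin n => Follows (flatten π) u
  let E := exceptional T π
  have hw := nodup_flatten π
  have hsub : (Finset.univ.filter fun u : Fin 3 → Fin n =>
      (Follows (flatten π) u ∧ OrderIsomorphic u σ) ∧ ¬ IsDeep π u) ⊆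
      (F.filter fun u => u 0 ∈ E) ∪ (F.filter fun u => u 1 ∈ E) ∪
        (F.filter fun u => u 2 ∈ E) := by
    intro u hu
    simp only [Finset.mem_filter, Finset.mem_univ, true_and] at hu
    obtain ⟨a, ha⟩ := exists_mem_exceptional T hu.2
    simp only [F, Finset.mem_union, Finset.mem_filter, Finset.mem_univ, true_and, hu.1.1]
    fin_cases a
    · exact Or.inl (Or.inl ha)
    · exact Or.inl (Or.inr ha)
    · exact Or.inr ha
  -- Adjacent letters determine each other, so two letters determine the triple. With one of them
  -- exceptional and the other free, each position of the exceptional letter contributes at most `n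
  -- * E.card`.
  have hext : ∀ u ∈ F, ∀ v ∈ F, (u 0 = v 0 ∨ u 1 = v 1) → u 2 = v 2 → u = v := by
    intro u hu v hv h h2
    simp only [F, Finset.mem_filter, Finset.mem_univ, true_and] at hu hv
    have h01 : u 0 = v 0 ∧ u 1 = v 1 := by
      rcases h with h | h
      · exact ⟨h, hu.eq_of_first hw hv h⟩
      · exact ⟨hu.eq_of_second hw hv h, h⟩
    funext a
    fin_cases a
    · exact h01.1
    · exact h01.2
    · exact h2
  have h0 : (F.filter fun u => u 0 ∈ E).card ≤ (E ×ˢ (Finset.univ : Finset (Fin n))).card := by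
    refine Finset.card_le_card_of_injOn (fun u => (u 0, u 2)) (fun u hu => ?_) ?_
    · simpa using (Finset.mem_filter.mp hu).2
    · intro u hu v hv h
      exact hext u (Finset.mem_filter.mp hu).1 v (Finset.mem_filter.mp hv).1
        (Or.inl (Prod.mk.inj h).1) (Prod.mk.inj h).2
  have h1 : (F.filter fun u => u 1 ∈ E).card ≤ (E ×ˢ (Finset.univ : Finset (Fin n))).card := by
    refine Finset.card_le_card_of_injOn (fun u => (u 1, u 2)) (fun u hu => ?_) ?_
    · simpa using (Finset.mem_filter.mp hu).2
    · intro u hu v hv h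
      exact hext u (Finset.mem_filter.mp hu).1 v (Finset.mem_filter.mp hv).1
        (Or.inr (Prod.mk.inj h).1) (Prod.mk.inj h).2
  have h2 : (F.filter fun u => u 2 ∈ E).card ≤ ((Finset.univ : Finset (Fin n)) ×ˢ E).card := by
    refine Finset.card_le_card_of_injOn (fun u => (u 0, u 2)) (fun u hu => ?_) ?_
    · simpa using (Finset.mem_filter.mp hu).2
    · intro u hu v hv h
      exact hext u (Finset.mem_filter.mp hu).1 v (Finset.mem_filter.mp hv).1
        (Or.inl (Prod.mk.inj h).1) (Prod.mk.inj h).2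
  simp only [Finset.card_product, Finset.card_univ, Fintype.card_fin] at h0 h1 h2
  have := Finset.card_le_card hsub
  have u1 := Finset.card_union_le ((F.filter fun u => u 0 ∈ E) ∪ (F.filter fun u => u 1 ∈ E))
    (F.filter fun u => u 2 ∈ E)
  have u2 := Finset.card_union_le (F.filter fun u => u 0 ∈ E) (F.filter fun u => u 1 ∈ E)
  change _ ≤ 3 * n * E.card
  linarith

/-- Double counting of the pairs (π, x) with x shallow; the factor `T` avoids division in ℕ. -/
theorem mul_sum_card_exceptional_le {T : ℕ} (hT : T ≤ n) :
    T * ∑ π : Perm (Fin n), (exceptional T π).card ≤ (T * T + n) * n.factorial := by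
  classical
  have h : ∀ π : Perm (Fin n), (exceptional T π).card ≤
      T + (Finset.univ.filter fun x => Shallow T π x).card := fun π => by
    unfold exceptional
    rw [Finset.filter_or]
    refine (Finset.card_union_le _ _).trans (Nat.add_le_add_right ?_ _)
    rw [Fin.card_filter_val_lt]
    exact min_le_right _ _
  have hswap : ∑ π : Perm (Fin n), (Finset.univ.filter fun x => Shallow T π x).card =
      ∑ x : Fin n, (Finset.univ.filter fun π : Perm (Fin n) => Shallow T π x).card := by
    simp only [Finset.card_filter]
    exact Finset.sum_comm
  calc T * ∑ π : Perm (Fin n), (exceptional T π).card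
      ≤ T * ∑ π : Perm (Fin n), (T + (Finset.univ.filter fun x => Shallow T π x).card) :=
        Nat.mul_le_mul_left _ (Finset.sum_le_sum fun π _ => h π)
    _ = T * T * n.factorial +
          ∑ x : Fin n, T * (Finset.univ.filter fun π : Perm (Fin n) => Shallow T π x).card := by
        rw [Finset.sum_add_distrib, hswap, Finset.sum_const, Finset.card_univ,
          Fintype.card_perm, Fintype.card_fin, ← Finset.mul_sum, smul_eq_mul]
        ring
    _ ≤ T * T * n.factorial + ∑ _x : Fin n, n.factorial :=
        Nat.add_le_add_left (Finset.sum_le_sum fun x _ => mul_card_shallow_le hT x) _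
    _ = (T * T + n) * n.factorial := by
        rw [Finset.sum_const, Finset.card_univ, Fintype.card_fin, smul_eq_mul]
        ring

theorem card_occurrences_le (T : ℕ) (σ σ' : Perm (Fin 3)) :
    (occurrences n σ).card ≤ (occurrences n σ').card +
      3 * n * ∑ π : Perm (Fin n), (exceptional T π).card := by
  classical
  rw [← Finset.card_filter_add_card_filter_not (s := occurrences n σ) fun p => IsDeep p.1 p.2]
  refine Nat.add_le_add (card_deep_occurrences_le σ σ') ?_
  rw [Finset.mul_sum]
  refine le_trans (le_of_eq ?_) (Finset.sum_le_sum fun π _ => card_not_deep_le T π σ)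
  rw [occurrences, Finset.filter_filter]
  simp only [Finset.card_filter, Fintype.sum_prod_type]

/-! ### The average -/

theorem avr_eq (σ : Perm (Fin 3)) (n : ℕ) :
    avr σ n = ((occurrences n σ).card : ℝ) / n.factorial := by
  rw [avr, ← sum_occ_flatten, Nat.cast_sum]

theorem avr_le_add (σ σ' : Perm (Fin 3)) {T : ℕ} (hT0 : 0 < T) (hT : T * T ≤ n) :
    avr σ n ≤ avr σ' n + 6 * (n : ℝ) ^ 2 / T := by
  have hTn : T ≤ n := (Nat.le_mul_self T).trans hT
  have h₁ := card_occurrences_le (n := n) T σ σ'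
  have h₂ := mul_sum_card_exceptional_le hTn
  have hf : (0 : ℝ) < n.factorial := by exact_mod_cast n.factorial_pos
  have hTr : (0 : ℝ) < T := by exact_mod_cast hT0
  set S := ∑ π : Perm (Fin n), (exceptional T π).card
  -- `T * T ≤ n` absorbs the contribution of the small letters: `T * T + n ≤ 2 * n`.
  have h₃ : (S : ℝ) ≤ 2 * n / T * n.factorial := by
    have h : (T : ℝ) * S ≤ (T * T + n) * n.factorial := by exact_mod_cast h₂
    have hT' : (T : ℝ) * T ≤ n := by exact_mod_cast hT
    rw [div_mul_eq_mul_div, le_div_iff₀ hTr]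
    nlinarith
  have h₄ : ((occurrences n σ).card : ℝ) ≤ (occurrences n σ').card + 3 * n * S := by
    exact_mod_cast h₁
  rw [avr_eq, avr_eq, div_add' _ _ _ hf.ne', div_le_div_iff_of_pos_right hf]
  refine h₄.trans (add_le_add_right ?_ _)
  calc 3 * (n : ℝ) * S ≤ 3 * n * (2 * n / T * n.factorial) := by gcongr
    _ = 6 * (n : ℝ) ^ 2 / T * n.factorial := by ring

theorem sum_avr (hn : 2 ≤ n) :
    ∑ σ : Perm (Fin 3), avr σ n = ((n : ℝ) - 1) * (n - 2) / 2 := by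
  have hf : (0 : ℝ) < n.factorial := by exact_mod_cast n.factorial_pos
  have h : (∑ σ : Perm (Fin 3), ∑ π : Perm (Fin n), occ σ (flatten π)) * 2 =
      n.factorial * ((n - 1) * (n - 2)) := by
    rw [Finset.sum_comm, Finset.sum_mul]
    simp only [sum_occ_mul_two (nodup_flatten _), length_flatten]
    rw [Finset.sum_const, Finset.card_univ, Fintype.card_perm, Fintype.card_fin, smul_eq_mul]
  have h' : (∑ σ : Perm (Fin 3), ∑ π : Perm (Fin n), (occ σ (flatten π) : ℝ)) * 2 =
      n.factorial * (((n : ℝ) - 1) * (n - 2)) := by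
    have := congrArg (Nat.cast (R := ℝ)) h
    push_cast [Nat.cast_sub hn, Nat.cast_sub (one_le_two.trans hn)] at this
    exact this
  simp only [avr]
  rw [← Finset.sum_div, div_eq_div_iff hf.ne' two_ne_zero, h']
  ring

theorem abs_avr_sub_le (σ : Perm (Fin 3)) {T : ℕ} (hT0 : 0 < T) (hT : T * T ≤ n) (hn : 2 ≤ n) :
    |avr σ n - ((n : ℝ) - 1) * (n - 2) / 12| ≤ 6 * (n : ℝ) ^ 2 / T := by
  have hcard : (Finset.univ : Finset (Perm (Fin 3))).card = 6 := by
    rw [Finset.card_univ, Fintype.card_perm, Fintype.card_fin]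
    rfl
  -- Summed over the six `σ'`, the two-sided comparison places `6 * avr σ n` within six error terms
  -- of the known total.
  have h₁ := Finset.sum_le_sum fun σ' (_ : σ' ∈ Finset.univ) => avr_le_add σ σ' hT0 hT
  have h₂ := Finset.sum_le_sum fun σ' (_ : σ' ∈ Finset.univ) => avr_le_add σ' σ hT0 hT
  rw [Finset.sum_add_distrib, sum_avr hn] at h₁
  rw [sum_avr hn] at h₂
  simp only [Finset.sum_const, hcard, nsmul_eq_mul] at h₁ h₂
  push_cast at h₁ h₂
  rw [abs_le]
  constructor <;> linarith

theorem tendsto_natSqrt_atTop : Filter.Tendsto Nat.sqrt Filter.atTop Filter.atTop :=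
  Filter.tendsto_atTop_atTop.mpr fun b => ⟨b * b, fun _ ha => Nat.le_sqrt.mpr ha⟩

end FlattenedPerm

open FlattenedPerm in
theorem mainTheorem6 (σ : Equiv.Perm (Fin 3)) :
    Filter.Tendsto (fun n : ℕ => FlattenedPerm.avr σ n / (n : ℝ) ^ 2) Filter.atTop
      (nhds (1 / 12 : ℝ)) := by
  have hinv : Filter.Tendsto (fun n : ℕ => (n : ℝ)⁻¹) Filter.atTop (nhds 0) :=
    tendsto_inv_atTop_nhds_zero_nat
  have hmain : Filter.Tendsto (fun n : ℕ => (1 - (n : ℝ)⁻¹) * (1 - 2 * (n : ℝ)⁻¹) / 12)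
      Filter.atTop (nhds (1 / 12)) := by
    have := ((hinv.const_sub 1).mul ((hinv.const_mul 2).const_sub 1)).div_const 12
    simpa using this
  have herr : Filter.Tendsto (fun n : ℕ => 6 * ((Nat.sqrt n : ℕ) : ℝ)⁻¹) Filter.atTop
      (nhds 0) := by
    simpa using (hinv.comp tendsto_natSqrt_atTop).const_mul 6
  have hdiff : Filter.Tendsto (fun n : ℕ => avr σ n / (n : ℝ) ^ 2 -
      (1 - (n : ℝ)⁻¹) * (1 - 2 * (n : ℝ)⁻¹) / 12) Filter.atTop (nhds 0) := by
    refine squeeze_zero_norm' ?_ herr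
    filter_upwards [Filter.eventually_ge_atTop 2] with n hn
    have hn0 : (0 : ℝ) < n := by exact_mod_cast (by omega : 0 < n)
    -- The threshold is `T = Nat.sqrt n`, the largest one satisfying `T * T ≤ n`; after division by
    -- `n ^ 2` the error is `6 / T`, which tends to 0.
    have h := abs_avr_sub_le σ (Nat.sqrt_pos.mpr (by omega : 0 < n)) (Nat.sqrt_le n) hn
    have he : avr σ n / (n : ℝ) ^ 2 - (1 - (n : ℝ)⁻¹) * (1 - 2 * (n : ℝ)⁻¹) / 12 =
        (avr σ n - ((n : ℝ) - 1) * (n - 2) / 12) / (n : ℝ) ^ 2 := by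
      field_simp
    rw [he, Real.norm_eq_abs, abs_div, abs_of_pos (pow_pos hn0 2), div_le_iff₀ (pow_pos hn0 2)]
    calc _ ≤ _ := h
      _ = _ := by ring
  simpa using hdiff.add hmain
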